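/- Proposition 4.4. Let $G$ be a complex linear algebraic group (not necessarily connected or reductive), that is, a Zariski-closed subgroup of some $\mathrm{GL}_m(\mathbb{C})$. Suppose that its group of rational characters $X(G)=\{\chi:G\to\mathbb{C}^\times \mid \chi \text{ is a rational homomorphism}\}$ is trivial, $X(G)=\{1\}$. Then $G$ does not admit a rational linear étale representation on a non-zero vector space: there are no finite-dimensional complex vector space $V$ with $\dim V>0$ and rational representation $\varrho: G\to \mathrm{GL}(V)$ such that $G$ has a Zariski-open orbit in $V$ and $\dim G=\dim V$. -/

import Mathlib

namespace EtaleModule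

/-- The algebra of polynomial functions on a complex vector space `W`: the functions `W → ℂ`
generated by the linear forms and the constants. -/
def polynomialFunctions (W : Type*) [AddCommGroup W] [Module ℂ W] : Subalgebra ℂ (W → ℂ) :=
  Algebra.adjoin ℂ (Set.range fun (φ : Module.Dual ℂ W) (w : W) => φ w)

/-- A subset of a complex vector space is Zariski closed if it is the set of common zeros of some
set of polynomial functions. -/
def IsZariskiClosed {W : Type*} [AddCommGroup W] [Module ℂ W] (Z : Set W) : Prop :=
  ∃ S : Set (W → ℂ), S ⊆ polynomialFunctions W ∧ Z = {w | ∀ f ∈ S, f w = 0}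

/-- A subset of a complex vector space is Zariski open if its complement is Zariski closed. -/
def IsZariskiOpen {W : Type*} [AddCommGroup W] [Module ℂ W] (U : Set W) : Prop :=
  IsZariskiClosed Uᶜ

/-- A subgroup of `GL_m(ℂ)` is a (complex) linear algebraic group if it is Zariski closed in
`GL_m(ℂ)`, that is, if it is the intersection of `GL_m(ℂ)` with a Zariski closed subset of the
vector space of all `m × m` matrices. -/
def IsLinearAlgebraicGroup {m : ℕ} (G : Subgroup (Matrix.GeneralLinearGroup (Fin m) ℂ)) : Prop :=
  ∃ Z : Set (Matrix (Fin m) (Fin m) ℂ), IsZariskiClosed Z ∧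
    ∀ g : Matrix.GeneralLinearGroup (Fin m) ℂ, g ∈ G ↔ (g : Matrix (Fin m) (Fin m) ℂ) ∈ Z

/-- The coordinate ring `ℂ[G]` of regular functions on `G ≤ GL_m(ℂ)`: the functions `G → ℂ` that
are polynomials in the matrix entries and the inverse of the determinant. -/
def coordinateRing {m : ℕ} (G : Subgroup (Matrix.GeneralLinearGroup (Fin m) ℂ)) :
    Subalgebra ℂ (G → ℂ) :=
  Algebra.adjoin ℂ
    ((Set.range fun (ij : Fin m × Fin m) (g : G) =>
        ((g : Matrix.GeneralLinearGroup (Fin m) ℂ) : Matrix (Fin m) (Fin m) ℂ) ij.1 ij.2) ∪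
      {fun g : G =>
        ((g : Matrix.GeneralLinearGroup (Fin m) ℂ) : Matrix (Fin m) (Fin m) ℂ).det⁻¹})

/-- The dimension of a linear algebraic group: the Krull dimension of its coordinate ring. -/
noncomputable def dimension {m : ℕ} (G : Subgroup (Matrix.GeneralLinearGroup (Fin m) ℂ)) :
    WithBot ℕ∞ :=
  ringKrullDim (coordinateRing G)

/-- The group `X(G)` of rational characters of `G`: the homomorphisms `χ : G → ℂˣ` that are
morphisms of algebraic varieties, i.e. both coordinates `χ` and `χ⁻¹` of the map to `ℂˣ` are
regular functions on `G`. -/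
def rationalCharacters {m : ℕ} (G : Subgroup (Matrix.GeneralLinearGroup (Fin m) ℂ)) :
    Subgroup (G →* ℂˣ) where
  carrier := {χ | (fun g : G => (χ g : ℂ)) ∈ coordinateRing G ∧
    (fun g : G => ((χ g)⁻¹ : ℂ)) ∈ coordinateRing G}
  one_mem' := by
    constructor
    · exact (coordinateRing G).one_mem
    · convert (coordinateRing G).one_mem using 1
      funext g
      simp
  mul_mem' := by
    rintro χ ψ ⟨h1, h2⟩ ⟨h3, h4⟩
    refine ⟨?_, ?_⟩
    · convert (coordinateRing G).mul_mem h1 h3 using 1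
      funext g
      simp
    · convert (coordinateRing G).mul_mem h2 h4 using 1
      funext g
      simp [mul_comm]
  inv_mem' := by
    rintro χ ⟨h1, h2⟩
    refine ⟨?_, ?_⟩
    · simpa using h2
    · simpa using h1

section Representations

variable {m : ℕ} {G : Subgroup (Matrix.GeneralLinearGroup (Fin m) ℂ)}
  {V : Type*} [AddCommGroup V] [Module ℂ V]

/-- A linear representation of `G` is rational if all its matrix coefficients are regular
functions on `G`. -/
def IsRational (ρ : Representation ℂ G V) : Prop :=
  ∀ (φ : Module.Dual ℂ V) (v : V), (fun g : G => φ (ρ g v)) ∈ coordinateRing G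

/-- `(G, ρ, V)` is a prehomogeneous module: `ρ` is a rational representation and `G` has a
Zariski-open orbit in `V`. -/
def IsPrehomogeneous (ρ : Representation ℂ G V) : Prop :=
  IsRational ρ ∧ ∃ v : V, IsZariskiOpen (Set.range fun g : G => ρ g v)

/-- `ρ` is a (rational linear) étale representation: `(G, ρ, V)` is a prehomogeneous module and
`dim G = dim V`. -/
def IsEtale (ρ : Representation ℂ G V) : Prop :=
  IsPrehomogeneous ρ ∧ dimension G = (Module.finrank ℂ V : WithBot ℕ∞)

end Representations

end EtaleModule

/-!
Suppose that `G` has an open orbit `G v` in `V`, with `dim G = dim V`, and no nontrivial rational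
characters. The orbit map `g ↦ g v` makes the coordinate ring `A` of `G` an algebra over the ring `R`
of polynomial functions on `V`, a polynomial ring in `dim V` variables. The proof shows that `A` is
integral over `R`. By lying over and the Nullstellensatz, the orbit map is then surjective; so the
orbit contains `0`, hence is `{0}`, and `V = 0`.

As the orbit is dense, `R` embeds in `A`, and, by translating, `A` is torsion-free over `R`
(`eq_zero_of_orbitPullback_mul_eq_zero`). As `dim A = dim R`, the ring `A` is algebraic over `R`
(`isAlgebraic_of_ringKrullDim_le`), so `A` becomes integral over `R` after inverting some nonzero
`f ∈ R`. The set `J` of all such `f` is stable under `G`, so its greatest common divisor `d` is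
multiplied by a scalar under each element of `G`. These scalars form a rational character, which is
trivial; so `d` is constant on the dense orbit, hence constant (`isUnit_of_dvd_substitute`). Thus no
prime of `R` divides all elements of `J`, that is, `A` is integral over `R` in codimension one. Since
`R` is factorial, `A` is integral over `R` (`isIntegral_of_forall_prime`, a consequence of Gauss's
lemma).
-/

/-! ### Dimension and integrality -/

section CommutativeAlgebra

open Polynomial

/-- By lying over and going up, a chain of primes of `R` lifts to a chain of the same length in `S`. -/
theorem ringKrullDim_le_of_isIntegral_of_injective {R S : Type*} [CommRing R] [CommRing S]
    [Algebra R S] [Algebra.IsIntegral R S] (h : Function.Injective (algebraMap R S)) :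
    ringKrullDim R ≤ ringKrullDim S := by
  refine iSup_le fun l => ?_
  obtain ⟨Q, -, hQ, hQl⟩ := Ideal.exists_ideal_over_prime_of_isIntegral (S := S) l.head.asIdeal ⊥
    (by rw [← RingHom.ker_eq_comap_bot, (RingHom.injective_iff_ker_eq_bot _).mp h]; exact bot_le)
  have : Q.LiesOver l.head.asIdeal := ⟨hQl.symm⟩
  obtain ⟨L, hL, -⟩ := Ideal.exists_ltSeries_of_hasGoingUp l Q
  rw [← hL]
  exact le_iSup (fun L : LTSeries (PrimeSpectrum S) => (L.length : WithBot ℕ∞)) L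

/-- By Noether normalization, the transcendence degree of a finitely generated domain is at most
its Krull dimension. -/
theorem trdeg_le_of_ringKrullDim_le {k D : Type*} [Field k] [CommRing D] [IsDomain D]
    [Algebra k D] [Algebra.FiniteType k D] {n : ℕ} (hn : ringKrullDim D ≤ n) :
    Algebra.trdeg k D ≤ n := by
  obtain ⟨s, g, hinj, hint⟩ := exists_integral_inj_algHom_of_fg k D
  let := g.toRingHom.toAlgebra
  have : IsScalarTower k (MvPolynomial (Fin s) k) D := .of_algebraMap_eq fun x => (g.commutes x).symm
  have : Algebra.IsIntegral (MvPolynomial (Fin s) k) D := ⟨hint⟩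
  have : FaithfulSMul (MvPolynomial (Fin s) k) D :=
    (faithfulSMul_iff_algebraMap_injective _ _).mpr hinj
  have h1 := ringKrullDim_le_of_isIntegral_of_injective (S := D) hinj
  rw [MvPolynomial.ringKrullDim_of_isNoetherianRing, ringKrullDim_eq_zero_of_field, zero_add] at h1
  have hs : s ≤ n := by
    have := h1.trans hn
    rw [Nat.card_fin] at this
    exact_mod_cast this
  have h2 := lift_trdeg_add_eq k (MvPolynomial (Fin s) k) D
  rw [trdeg_eq_zero (R := MvPolynomial (Fin s) k) (A := D)] at h2
  simp only [MvPolynomial.trdeg_of_isDomain, Cardinal.mk_fin, Cardinal.lift_natCast,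
    Cardinal.lift_zero, add_zero] at h2
  rw [← Cardinal.lift_le_nat_iff, ← h2]
  exact_mod_cast hs

/-- If `A` is a finitely generated algebra of dimension at most `n`, then it is algebraic over every
polynomial ring in `n` variables that maps to it. `A` need not be a domain: a transcendental element
gives a polynomial ring in `n + 1` variables inside `A`, and it stays embedded modulo a suitable
prime of `A`. -/
theorem isAlgebraic_of_ringKrullDim_le {k R A : Type*} [Field k] [CommRing R] [CommRing A]
    [Algebra k R] [Algebra k A] [Algebra R A] [IsScalarTower k R A] [Algebra.FiniteType k A] {n : ℕ}
    (hn : ringKrullDim A ≤ n) (e : MvPolynomial (Fin n) k ≃ₐ[k] R) : Algebra.IsAlgebraic R A := by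
  refine ⟨fun a => ?_⟩
  by_contra ha
  have hinj : Function.Injective (aeval a : R[X] →ₐ[R] A) := transcendental_iff_injective.mp ha
  have : IsDomain R := e.symm.toMulEquiv.isDomain
  obtain ⟨P, hP, hPc⟩ := Ideal.exists_comap_eq_of_mem_minimalPrimes_of_injective
    (f := (aeval a : R[X] →ₐ[R] A).toRingHom) hinj ⊥
    (by simp [IsDomain.minimalPrimes_eq_singleton_bot])
  have hn' : ringKrullDim (A ⧸ P) ≤ n := (ringKrullDim_quotient_le P).trans hn
  have h1 := trdeg_le_of_ringKrullDim_le (k := k) hn'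
  let f : R[X] →ₐ[k] A ⧸ P :=
    (Ideal.Quotient.mkₐ k P).comp ((aeval a : R[X] →ₐ[R] A).restrictScalars k)
  have hf : Function.Injective f := by
    rw [injective_iff_map_eq_zero]
    intro p hp
    have : p ∈ P.comap (aeval a : R[X] →ₐ[R] A).toRingHom := by
      rw [Ideal.mem_comap, ← Ideal.Quotient.eq_zero_iff_mem]
      exact hp
    rwa [hPc] at this
  have h2 := lift_trdeg_le_of_injective f hf
  have h3 := trdeg_add_eq k R (A := R[X])
  have h4 := AlgEquiv.lift_trdeg_eq e
  simp only [MvPolynomial.trdeg_of_isDomain, Cardinal.mk_fin, Cardinal.lift_natCast] at h4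
  rw [eq_comm, Cardinal.lift_eq_nat_iff] at h4
  rw [h4, Polynomial.trdeg_of_isDomain] at h3
  rw [← h3] at h2
  have h5 := h2.trans (Cardinal.lift_le_nat_iff.mpr h1)
  simp only [Cardinal.lift_add, Cardinal.lift_natCast, Cardinal.lift_one] at h5
  norm_cast at h5
  omega

/-- A form of Gauss's lemma. -/
theorem Polynomial.IsPrimitive.dvd_of_dvd_C_mul {R : Type*} [CommRing R] [IsDomain R]
    [UniqueFactorizationMonoid R] {F H : R[X]} (hF : F.IsPrimitive) {c : R} (hc : c ≠ 0)
    (h : F ∣ C c * H) : F ∣ H := by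
  classical
  let := UniqueFactorizationMonoid.strongNormalizationMonoid (α := R)
  let := UniqueFactorizationMonoid.toNormalizedGCDMonoid R
  rcases eq_or_ne H 0 with rfl | hH
  · exact dvd_zero F
  have h0 : C c * H ≠ 0 := mul_ne_zero (C_ne_zero.mpr hc) hH
  rw [← hF.dvd_primPart_iff_dvd h0, (associated_primPart_mul h0).dvd_iff_dvd_right,
    (isUnit_primPart_C c).dvd_mul_left] at h
  exact (hF.dvd_primPart_iff_dvd hH).mp h

/-- Over a factorial domain, the ideal of polynomials annihilating an algebraic element `a` of a
torsion-free algebra is principal: it is generated by a primitive annihilating polynomial of least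
degree. This takes the place of the minimal polynomial when `A` is not a domain. -/
theorem exists_forall_aeval_eq_zero_dvd {R A : Type*} [CommRing R] [IsDomain R]
    [UniqueFactorizationMonoid R] [CommRing A] [Algebra R A] [Module.IsTorsionFree R A] {a : A}
    (ha : IsAlgebraic R a) :
    ∃ F : R[X], F ≠ 0 ∧ aeval a F = 0 ∧ ∀ H : R[X], aeval a H = 0 → F ∣ H := by
  classical
  let := UniqueFactorizationMonoid.strongNormalizationMonoid (α := R)
  let := UniqueFactorizationMonoid.toNormalizedGCDMonoid R
  obtain ⟨p, ⟨hp0, hpa⟩, hmin⟩ := exists_minimalFor_of_wellFoundedLT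
    (fun p : R[X] => p ≠ 0 ∧ aeval a p = 0) natDegree ha
  have hc0 : p.content ≠ 0 := fun h => hp0 (content_eq_zero_iff.mp h)
  have hFa : aeval a p.primPart = 0 := by
    rw [p.eq_C_content_mul_primPart, map_mul, aeval_C, ← Algebra.smul_def] at hpa
    exact (smul_eq_zero_iff_right hc0).mp hpa
  have hprim := p.isPrimitive_primPart
  have hdeg : ∀ H : R[X], H ≠ 0 → aeval a H = 0 → p.primPart.natDegree ≤ H.natDegree := by
    intro H hH0 hHa
    rw [natDegree_primPart]
    exact (le_total _ _).elim id (hmin ⟨hH0, hHa⟩)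
  generalize p.primPart = F at *
  refine ⟨F, hprim.ne_zero, hFa, fun H => ?_⟩
  induction hn : H.natDegree using Nat.strong_induction_on generalizing H with
  | _ n ih =>
    intro hHa
    rcases eq_or_ne H 0 with rfl | hH0
    · exact dvd_zero F
    have hle := hdeg H hH0 hHa
    -- a constant primitive polynomial is a unit; this only happens when `A` is trivial
    rcases Nat.eq_zero_or_pos F.natDegree with hF0 | hFpos
    · have hFC := eq_C_of_natDegree_eq_zero hF0
      rw [hFC]
      exact ((hprim _ hFC.symm.dvd).map C).dvd
    have hpos : 0 < H.natDegree := hFpos.trans_le hle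
    -- cancel the leading term of `H` after scaling by the leading coefficient of `F`
    have hdvd : F ∣ F.cancelLeads H := by
      refine ih _ (hn ▸ natDegree_cancelLeads_lt_of_natDegree_le_natDegree hle hpos) _ rfl ?_
      simp [cancelLeads, hFa, hHa]
    rw [cancelLeads, Nat.sub_eq_zero_of_le hle, pow_zero, mul_one,
      dvd_sub_left (dvd_mul_left F _)] at hdvd
    exact hprim.dvd_of_dvd_C_mul (leadingCoeff_ne_zero.mpr hprim.ne_zero) hdvd

/-- Integrality in codimension one suffices over a factorial domain: if, for every prime element `p`,
some multiple of `a` by an element outside `(p)` is integral, then `a` is integral. Indeed no prime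
can divide the leading coefficient of the generator of the annihilating polynomials of `a`. -/
theorem isIntegral_of_forall_prime {R A : Type*} [CommRing R] [IsDomain R]
    [UniqueFactorizationMonoid R] [CommRing A] [Algebra R A] [Module.IsTorsionFree R A] {a : A}
    (ha : IsAlgebraic R a)
    (h : ∀ p : R, Prime p → ∃ f : R, ¬ p ∣ f ∧ IsIntegral R (f • a)) : IsIntegral R a := by
  obtain ⟨F, hF0, hFa, hF⟩ := exists_forall_aeval_eq_zero_dvd ha
  have hu : IsUnit F.leadingCoeff := by
    by_contra hu
    obtain ⟨p, hp, hpF⟩ := WfDvdMonoid.exists_irreducible_factor hu (leadingCoeff_ne_zero.mpr hF0)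
    obtain ⟨f, hpf, M, hM, hMa⟩ := h p hp.prime
    refine hpf (hp.prime.dvd_of_dvd_pow (n := M.natDegree) (hpF.trans ?_))
    -- `M (f X)` annihilates `a` and has a power of `f` as its leading coefficient
    have h1 : F ∣ M.comp (C f * X) := hF _ (by
      rw [aeval_comp, map_mul, aeval_C, aeval_X, ← Algebra.smul_def]; exact hMa)
    have h2 := leadingCoeff_dvd_leadingCoeff h1
    have hf0 : f ≠ 0 := by rintro rfl; exact hpf (dvd_zero p)
    rwa [leadingCoeff_comp (by rw [natDegree_C_mul_X _ hf0]; exact one_ne_zero), hM.leadingCoeff,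
      one_mul, leadingCoeff_C_mul_X] at h2
  obtain ⟨u, hu⟩ := hu
  refine ⟨C (↑u⁻¹ : R) * F, ?_, ?_⟩
  · rw [Monic, leadingCoeff_mul, leadingCoeff_C, ← hu, Units.inv_mul]
  · rw [← aeval_def, map_mul, hFa, mul_zero]

/-- In a Noetherian factorial domain every set has a greatest common divisor. -/
theorem exists_gcd_of_set {R : Type*} [CommRing R] [IsDomain R] [UniqueFactorizationMonoid R]
    [IsNoetherianRing R] (J : Set R) : ∃ d : R, ∀ h, h ∣ d ↔ ∀ f ∈ J, h ∣ f := by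
  classical
  let := UniqueFactorizationMonoid.strongNormalizationMonoid (α := R)
  let := UniqueFactorizationMonoid.toNormalizedGCDMonoid R
  obtain ⟨T, hT⟩ := IsNoetherian.noetherian (Ideal.span J)
  refine ⟨T.gcd id, fun h => ?_⟩
  have key : ∀ S : Set R, (∀ f ∈ S, h ∣ f) ↔ Ideal.span S ≤ Ideal.span {h} := fun S => by
    rw [Ideal.span_le]
    exact forall₂_congr fun f _ => Ideal.mem_span_singleton.symm
  rw [Finset.dvd_gcd_iff, key J, ← hT]
  exact key T

/-- If the finitely generated algebra `A` is algebraic over `R`, then it becomes integral after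
inverting a single nonzero element of `R`. -/
theorem exists_ne_zero_forall_exists_pow_smul_isIntegral (k : Type*) {R A : Type*} [CommRing k]
    [CommRing R] [IsDomain R] [CommRing A]
    [Algebra k R] [Algebra k A] [Algebra R A] [IsScalarTower k R A] [Algebra.FiniteType k A]
    [Algebra.IsAlgebraic R A] :
    ∃ f : R, f ≠ 0 ∧ ∀ a : A, ∃ N : ℕ, IsIntegral R (f ^ N • a) := by
  obtain ⟨T, hT⟩ := ‹Algebra.FiniteType k A›.out
  choose y hy0 hy using fun a : A =>
    (Algebra.IsAlgebraic.isAlgebraic (R := R) a).exists_integral_multiple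
  have hle : ∀ (f : R) (N M : ℕ) (a : A), N ≤ M → IsIntegral R (f ^ N • a) →
      IsIntegral R (f ^ M • a) := fun f N M a hNM h => by
    rw [← Nat.sub_add_cancel hNM, pow_add, mul_smul]
    exact h.smul _
  refine ⟨∏ t ∈ T, y t, Finset.prod_ne_zero_iff.mpr fun t _ => hy0 t, fun a => ?_⟩
  have ha : a ∈ Algebra.adjoin k (T : Set A) := hT ▸ Algebra.mem_top
  induction ha using Algebra.adjoin_induction with
  | mem t ht =>
    refine ⟨1, ?_⟩
    obtain ⟨c, hc⟩ := Finset.dvd_prod_of_mem y ht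
    rw [pow_one, hc, mul_comm, mul_smul]
    exact (hy t).smul c
  | algebraMap r =>
    refine ⟨0, ?_⟩
    rw [pow_zero, one_smul, IsScalarTower.algebraMap_apply k R A]
    exact isIntegral_algebraMap
  | add a b _ _ ha hb =>
    obtain ⟨N, hN⟩ := ha
    obtain ⟨M, hM⟩ := hb
    refine ⟨max N M, ?_⟩
    rw [smul_add]
    exact (hle _ _ _ _ (le_max_left _ _) hN).add (hle _ _ _ _ (le_max_right _ _) hM)
  | mul a b _ _ ha hb =>
    obtain ⟨N, hN⟩ := ha
    obtain ⟨M, hM⟩ := hb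
    refine ⟨N + M, ?_⟩
    rw [pow_add, ← smul_mul_smul_comm]
    exact hN.mul hM

end CommutativeAlgebra

namespace EtaleModule

/-! ### Polynomial functions on a vector space -/

section PolynomialFunctions

variable {X W : Type*} [AddCommGroup W] [Module ℂ W]

/-- Precomposition with `u : X → Y`, as a homomorphism of algebras of complex functions. -/
def precomp {X Y : Type*} (u : X → Y) : (Y → ℂ) →ₐ[ℂ] (X → ℂ) :=
  AlgHom.pi fun x => Pi.evalAlgHom ℂ (fun _ : Y => ℂ) (u x)

/-- The pullback of polynomial functions on `W` along a map `u : X → W`, as a homomorphism into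
an algebra `A` of functions on `X` that contains the pullbacks of all linear forms. -/
def pullback (A : Subalgebra ℂ (X → ℂ)) (u : X → W)
    (hu : ∀ φ : Module.Dual ℂ W, (fun x => φ (u x)) ∈ A) : polynomialFunctions W →ₐ[ℂ] A :=
  ((precomp u).comp (polynomialFunctions W).val).codRestrict A fun f => by
    have h : polynomialFunctions W ≤ A.comap (precomp u) :=
      Algebra.adjoin_le (by rintro _ ⟨φ, rfl⟩; exact hu φ)
    exact h f.2

@[simp]
theorem pullback_apply (A : Subalgebra ℂ (X → ℂ)) (u : X → W)
    (hu : ∀ φ : Module.Dual ℂ W, (fun x => φ (u x)) ∈ A) (f : polynomialFunctions W) (x : X) :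
    (pullback A u hu f : X → ℂ) x = (f : W → ℂ) (u x) := rfl

theorem linearForm_mem_polynomialFunctions (φ : Module.Dual ℂ W) :
    (fun w => φ w) ∈ polynomialFunctions W :=
  Algebra.subset_adjoin ⟨φ, rfl⟩

/-- A basis of `W` identifies the polynomial functions on `W` with polynomials in the
coordinates. -/
noncomputable def polynomialFunctionsEquiv {n : ℕ} (b : Module.Basis (Fin n) ℂ W) :
    MvPolynomial (Fin n) ℂ ≃ₐ[ℂ] polynomialFunctions W :=
  AlgEquiv.ofBijective
    (MvPolynomial.aeval fun i =>
      (⟨fun w => b.coord i w, linearForm_mem_polynomialFunctions _⟩ : polynomialFunctions W)) <| by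
    set F := MvPolynomial.aeval (R := ℂ) fun i =>
      (⟨fun w => b.coord i w, linearForm_mem_polynomialFunctions _⟩ : polynomialFunctions W) with hF
    have hFw : ∀ p w, (F p : W → ℂ) w = MvPolynomial.eval (fun i => b.coord i w) p := by
      intro p w
      have : ((Pi.evalAlgHom ℂ (fun _ : W => ℂ) w).comp
          ((polynomialFunctions W).val.comp F)) = MvPolynomial.aeval fun i => b.coord i w := by
        ext i
        simp [hF]
      rw [← MvPolynomial.coe_aeval_eq_eval]
      exact DFunLike.congr_fun this p
    constructor
    · rw [injective_iff_map_eq_zero]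
      intro p hp
      refine MvPolynomial.funext fun x => ?_
      have := hFw p (b.equivFun.symm x)
      rw [hp] at this
      simp only [Module.Basis.coord_equivFun_symm] at this
      simpa using this.symm
    · rintro ⟨f, hf⟩
      have h : polynomialFunctions W ≤ ((polynomialFunctions W).val.comp F).range := by
        refine Algebra.adjoin_le ?_
        rintro _ ⟨φ, rfl⟩
        refine ⟨∑ i, MvPolynomial.C (φ (b i)) * MvPolynomial.X i, funext fun w => ?_⟩
        change (F _ : W → ℂ) w = φ w
        rw [hFw]
        conv_rhs => rw [← b.sum_repr w]
        simp only [map_sum, map_mul, map_smul, MvPolynomial.eval_C, MvPolynomial.eval_X,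
          Module.Basis.coord_apply, smul_eq_mul, mul_comm]
      obtain ⟨p, hp⟩ := h hf
      exact ⟨p, Subtype.ext hp⟩

variable [FiniteDimensional ℂ W]

instance : IsDomain (polynomialFunctions W) :=
  (polynomialFunctionsEquiv (Module.finBasis ℂ W)).symm.toMulEquiv.isDomain

instance : UniqueFactorizationMonoid (polynomialFunctions W) :=
  (polynomialFunctionsEquiv (Module.finBasis ℂ W)).toMulEquiv.uniqueFactorizationMonoid inferInstance

instance : IsNoetherianRing (polynomialFunctions W) :=
  isNoetherianRing_of_ringEquiv _ (polynomialFunctionsEquiv (Module.finBasis ℂ W)).toRingEquiv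

theorem exists_eq_algebraMap_of_isUnit {f : polynomialFunctions W} (hf : IsUnit f) :
    ∃ c : ℂ, c ≠ 0 ∧ f = algebraMap ℂ _ c := by
  let e := polynomialFunctionsEquiv (Module.finBasis ℂ W)
  obtain ⟨c, hc, h⟩ := MvPolynomial.isUnit_iff_eq_C_of_isReduced.mp (hf.map e.symm)
  refine ⟨c, hc.ne_zero, e.symm.injective ?_⟩
  rw [h, AlgEquiv.commutes, MvPolynomial.algebraMap_eq]

/-- A nonempty Zariski-open subset of a vector space is Zariski dense. -/
theorem eq_zero_of_forall_mem_isZariskiOpen {U : Set W} (hU : IsZariskiOpen U) (hne : U.Nonempty)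
    {f : polynomialFunctions W} (hf : ∀ w ∈ U, (f : W → ℂ) w = 0) : f = 0 := by
  obtain ⟨S, hS, hUS⟩ := hU
  obtain ⟨u, hu⟩ := hne
  have : ¬ ∀ s ∈ S, s u = 0 := fun h => (hUS.symm ▸ h : u ∈ Uᶜ) hu
  push Not at this
  obtain ⟨s, hs, hsu⟩ := this
  let s' : polynomialFunctions W := ⟨s, hS hs⟩
  have hs' : s' ≠ 0 := fun h => hsu (congr_fun (congr_arg Subtype.val h) u)
  refine (mul_eq_zero.mp (Subtype.ext (funext fun w => ?_) : f * s' = 0)).resolve_right hs'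
  by_cases hw : w ∈ U
  · exact mul_eq_zero_of_left (hf w hw) _
  · have : w ∈ Uᶜ := hw
    rw [hUS] at this
    exact mul_eq_zero_of_right _ (this s hs)

end PolynomialFunctions

/-! ### The coordinate ring of a linear algebraic group -/

section CoordinateRing

variable {m : ℕ} {G : Subgroup (Matrix.GeneralLinearGroup (Fin m) ℂ)}

variable (G) in
/-- The matrix entry `g ↦ g i j`, as a regular function on `G`. -/
def matrixEntry (i j : Fin m) : coordinateRing G :=
  ⟨fun g => ((g : Matrix.GeneralLinearGroup (Fin m) ℂ) : Matrix (Fin m) (Fin m) ℂ) i j,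
    Algebra.subset_adjoin (Or.inl ⟨(i, j), rfl⟩)⟩

variable (G) in
/-- The function `g ↦ (det g)⁻¹`, as a regular function on `G`. -/
noncomputable def detInv : coordinateRing G :=
  ⟨fun g => ((g : Matrix.GeneralLinearGroup (Fin m) ℂ) : Matrix (Fin m) (Fin m) ℂ).det⁻¹,
    Algebra.subset_adjoin (Or.inr rfl)⟩

/-- Evaluation of regular functions at a point of `G`. -/
def evalAt (g : G) : coordinateRing G →ₐ[ℂ] ℂ :=
  (Pi.evalAlgHom ℂ (fun _ : G => ℂ) g).comp (coordinateRing G).val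

@[simp]
theorem evalAt_apply (g : G) (a : coordinateRing G) : evalAt g a = (a : G → ℂ) g := rfl

instance : Algebra.FiniteType ℂ (coordinateRing G) :=
  (Subalgebra.fg_iff_finiteType _).mp <| Subalgebra.fg_def.mpr
    ⟨_, (Set.finite_range _).union (Set.finite_singleton _), rfl⟩

theorem algHom_ext_coordinateRing {ε ε' : coordinateRing G →ₐ[ℂ] ℂ}
    (h : ∀ i j, ε (matrixEntry G i j) = ε' (matrixEntry G i j))
    (hdet : ε (detInv G) = ε' (detInv G)) : ε = ε' := by
  refine AlgHom.adjoin_ext ?_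
  rintro _ (⟨⟨i, j⟩, rfl⟩ | rfl)
  · exact h i j
  · exact hdet

/-- Translation of regular functions by `h`, sending `a` to `g ↦ a (h * g)`. -/
def translate (h : G) : coordinateRing G →ₐ[ℂ] coordinateRing G :=
  ((precomp (h * ·)).comp (coordinateRing G).val).codRestrict _ fun a => by
    have key : coordinateRing G ≤ (coordinateRing G).comap (precomp (h * ·)) := by
      refine Algebra.adjoin_le ?_
      rintro _ (⟨⟨i, j⟩, rfl⟩ | rfl)
      · have : precomp (h * ·) (matrixEntry G i j : G → ℂ) =
            ∑ k, (h.1 : Matrix (Fin m) (Fin m) ℂ) i k • (matrixEntry G k j : G → ℂ) := by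
          ext g
          simp [matrixEntry, Matrix.mul_apply, precomp]
        change precomp (h * ·) (matrixEntry G i j : G → ℂ) ∈ coordinateRing G
        rw [this]
        exact sum_mem fun k _ => Subalgebra.smul_mem _ (matrixEntry G k j).2 _
      · have : precomp (h * ·) (detInv G : G → ℂ) =
            (h.1 : Matrix (Fin m) (Fin m) ℂ).det⁻¹ • (detInv G : G → ℂ) := by
          ext g
          simp [detInv, precomp, mul_comm]
        change precomp (h * ·) (detInv G : G → ℂ) ∈ coordinateRing G
        rw [this]
        exact Subalgebra.smul_mem _ (detInv G).2 _
    exact key a.2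

@[simp]
theorem translate_apply (h : G) (a : coordinateRing G) (g : G) :
    (translate h a : G → ℂ) g = (a : G → ℂ) (h * g) := rfl

/-- The points of `G` are the `ℂ`-algebra homomorphisms from its coordinate ring to `ℂ`. Here it is
used that `G` is closed. -/
theorem exists_eq_evalAt (hG : IsLinearAlgebraicGroup G) (ε : coordinateRing G →ₐ[ℂ] ℂ) :
    ∃ g : G, ε = evalAt g := by
  obtain ⟨Z, ⟨S, hS, rfl⟩, hGZ⟩ := hG
  let x : Matrix (Fin m) (Fin m) ℂ := Matrix.of fun i j => ε (matrixEntry G i j)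
  have hx : x = ε.toRingHom.mapMatrix (Matrix.of (matrixEntry G)) := rfl
  have hdet : x.det * ε (detInv G) = 1 := by
    rw [hx, ← RingHom.map_det]
    change ε _ * ε _ = 1
    rw [← map_mul, ← map_one ε]
    congr 1
    ext g
    have h1 : evalAt g (Matrix.of (matrixEntry G)).det = (g.1 : Matrix (Fin m) (Fin m) ℂ).det :=
      AlgHom.map_det (evalAt g) _
    change evalAt g (Matrix.of (matrixEntry G)).det * (g.1 : Matrix (Fin m) (Fin m) ℂ).det⁻¹ = 1
    rw [h1]
    exact mul_inv_cancel₀ (g.1.isUnit.map Matrix.detMonoidHom).ne_zero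
  let g : Matrix.GeneralLinearGroup (Fin m) ℂ :=
    Matrix.GeneralLinearGroup.mkOfDetNeZero x (left_ne_zero_of_mul_eq_one hdet)
  have hφ : ∀ (φ : Module.Dual ℂ (Matrix (Fin m) (Fin m) ℂ)) M,
      φ M = ∑ i, ∑ j, φ (Matrix.single i j 1) * M i j := fun φ M => by
    conv_lhs => rw [Matrix.matrix_eq_sum_single M]
    simp only [map_sum]
    refine Finset.sum_congr rfl fun i _ => Finset.sum_congr rfl fun j _ => ?_
    rw [← mul_one (M i j), ← smul_eq_mul, ← Matrix.smul_single, map_smul, smul_eq_mul, smul_eq_mul,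
      mul_one, mul_comm]
  have hφG : ∀ φ : Module.Dual ℂ (Matrix (Fin m) (Fin m) ℂ),
      (fun g : G => φ (g.1 : Matrix (Fin m) (Fin m) ℂ)) =
        ((∑ i, ∑ j, φ (Matrix.single i j 1) • matrixEntry G i j : coordinateRing G) : G → ℂ) :=
    fun φ => by
      ext g
      rw [hφ]
      simp [matrixEntry]
  let res := pullback (coordinateRing G) (fun g : G => (g.1 : Matrix (Fin m) (Fin m) ℂ)) fun φ => by
    rw [hφG]
    exact SetLike.coe_mem _
  -- applying `ε` to the restriction to `G` of a polynomial in the entries evaluates it at `x`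
  have hres : ∀ f : polynomialFunctions (Matrix (Fin m) (Fin m) ℂ), ε (res f) = (f : _ → ℂ) x := by
    intro f
    have : ε.comp res = (Pi.evalAlgHom ℂ (fun _ => ℂ) x).comp (polynomialFunctions _).val := by
      refine AlgHom.adjoin_ext ?_
      rintro _ ⟨φ, rfl⟩
      change ε (res ⟨fun w => φ w, linearForm_mem_polynomialFunctions φ⟩) = φ x
      rw [hφ, show res ⟨fun w => φ w, linearForm_mem_polynomialFunctions φ⟩ =
        ∑ i, ∑ j, φ (Matrix.single i j 1) • matrixEntry G i j from Subtype.ext (hφG φ)]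
      simp [x]
    exact DFunLike.congr_fun this f
  have hg : g ∈ G := by
    rw [hGZ]
    intro f hf
    change f x = 0
    refine (hres ⟨f, hS hf⟩).symm.trans ?_
    rw [← map_zero ε]
    congr 1
    ext g
    exact (hGZ _).mp g.2 f hf
  refine ⟨⟨g, hg⟩, algHom_ext_coordinateRing (fun i j => rfl) ?_⟩
  exact eq_inv_of_mul_eq_one_right hdet

/-- Hilbert's Nullstellensatz on `G`: a proper ideal of the coordinate ring has a zero in `G`. -/
theorem exists_forall_mem_eq_zero (hG : IsLinearAlgebraicGroup G) {I : Ideal (coordinateRing G)}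
    (hI : I ≠ ⊤) : ∃ g : G, ∀ a ∈ I, (a : G → ℂ) g = 0 := by
  obtain ⟨M, hM, hIM⟩ := Ideal.exists_le_maximal I hI
  let : Field (coordinateRing G ⧸ M) := Ideal.Quotient.field M
  have : Module.Finite ℂ (coordinateRing G ⧸ M) := finite_of_finite_type_of_isJacobsonRing _ _
  have : Algebra.IsIntegral ℂ (coordinateRing G ⧸ M) := Algebra.IsIntegral.of_finite _ _
  let e := AlgEquiv.ofBijective (Algebra.ofId ℂ (coordinateRing G ⧸ M))
    (IsAlgClosed.algebraMap_bijective_of_isIntegral)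
  obtain ⟨g, hg⟩ := exists_eq_evalAt hG (e.symm.toAlgHom.comp (Ideal.Quotient.mkₐ ℂ M))
  refine ⟨g, fun a ha => ?_⟩
  have h1 : Ideal.Quotient.mkₐ ℂ M a = 0 := Ideal.Quotient.eq_zero_iff_mem.mpr (hIM ha)
  rw [← evalAt_apply, ← hg, AlgHom.comp_apply, h1, map_zero]

theorem isUnit_of_forall_ne_zero (hG : IsLinearAlgebraicGroup G) {a : coordinateRing G}
    (ha : ∀ g, (a : G → ℂ) g ≠ 0) : IsUnit a := by
  rw [← Ideal.span_singleton_eq_top]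
  by_contra h
  obtain ⟨g, hg⟩ := exists_forall_mem_eq_zero hG h
  exact ha g (hg a (Ideal.mem_span_singleton_self a))

end CoordinateRing

/-! ### The orbit map -/

section OrbitMap

variable {m : ℕ} {G : Subgroup (Matrix.GeneralLinearGroup (Fin m) ℂ)}
  {V : Type*} [AddCommGroup V] [Module ℂ V]

/-- The action of `h` on polynomial functions on `V`, sending `f` to `w ↦ f (ρ h w)`. -/
def substitute (ρ : Representation ℂ G V) (h : G) :
    polynomialFunctions V →ₐ[ℂ] polynomialFunctions V :=
  pullback _ (ρ h) fun φ => linearForm_mem_polynomialFunctions (φ ∘ₗ ρ h)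

@[simp]
theorem substitute_apply (ρ : Representation ℂ G V) (h : G) (f : polynomialFunctions V) (w : V) :
    (substitute ρ h f : V → ℂ) w = (f : V → ℂ) (ρ h w) := rfl

theorem substitute_substitute_inv (ρ : Representation ℂ G V) (h : G) (f : polynomialFunctions V) :
    substitute ρ h (substitute ρ h⁻¹ f) = f := by
  ext w
  simp

theorem substitute_injective (ρ : Representation ℂ G V) (h : G) :
    Function.Injective (substitute ρ h) :=
  Function.LeftInverse.injective (g := substitute ρ h⁻¹) fun f => by
    ext w
    simp

/-- The comorphism of the orbit map `g ↦ ρ g v`. -/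
def orbitPullback {ρ : Representation ℂ G V} (hρ : IsRational ρ) (v : V) :
    polynomialFunctions V →ₐ[ℂ] coordinateRing G :=
  pullback _ (fun g => ρ g v) fun φ => hρ φ v

@[simp]
theorem orbitPullback_apply {ρ : Representation ℂ G V} (hρ : IsRational ρ) (v : V)
    (f : polynomialFunctions V) (g : G) :
    (orbitPullback hρ v f : G → ℂ) g = (f : V → ℂ) (ρ g v) := rfl

theorem translate_orbitPullback {ρ : Representation ℂ G V} (hρ : IsRational ρ) (v : V) (h : G)
    (f : polynomialFunctions V) :
    translate h (orbitPullback hρ v f) = orbitPullback hρ v (substitute ρ h f) := by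
  ext g
  simp

variable [FiniteDimensional ℂ V]

theorem orbitPullback_injective {ρ : Representation ℂ G V} (hρ : IsRational ρ) {v : V}
    (hv : IsZariskiOpen (Set.range fun g : G => ρ g v)) :
    Function.Injective (orbitPullback hρ v) := by
  rw [injective_iff_map_eq_zero]
  intro f hf
  refine eq_zero_of_forall_mem_isZariskiOpen hv ⟨v, 1, by simp⟩ ?_
  rintro _ ⟨g, rfl⟩
  exact congr_fun (congr_arg Subtype.val hf) g

/-- The coordinate ring of `G` is torsion-free over the polynomial functions on `V`, even if `G` is
disconnected: the translates of a nonzero `a` generate the unit ideal, so that a nonzero `b` which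
kills `a` would give a nonzero polynomial function vanishing on the orbit. -/
theorem eq_zero_of_orbitPullback_mul_eq_zero (hG : IsLinearAlgebraicGroup G)
    {ρ : Representation ℂ G V} (hρ : IsRational ρ) {v : V}
    (hv : IsZariskiOpen (Set.range fun g : G => ρ g v)) {b : polynomialFunctions V} (hb : b ≠ 0)
    {a : coordinateRing G} (hab : orbitPullback hρ v b * a = 0) : a = 0 := by
  by_contra ha
  -- membership in the ideal yields such a `c` by taking products of translates of `b`
  have key : ∀ x ∈ Ideal.span (Set.range fun h => translate h a),
      ∃ c : polynomialFunctions V, c ≠ 0 ∧ orbitPullback hρ v c * x = 0 := by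
    intro x hx
    induction hx using Submodule.span_induction with
    | mem x hx =>
      obtain ⟨h, rfl⟩ := hx
      refine ⟨substitute ρ h b,
        (map_ne_zero_iff _ (substitute_injective ρ h)).mpr hb, ?_⟩
      rw [← translate_orbitPullback, ← map_mul, hab, map_zero]
    | zero => exact ⟨1, one_ne_zero, mul_zero _⟩
    | add x y _ _ hx hy =>
      obtain ⟨c, hc, hcx⟩ := hx
      obtain ⟨d, hd, hdy⟩ := hy
      refine ⟨c * d, mul_ne_zero hc hd, ?_⟩
      rw [map_mul]
      linear_combination orbitPullback hρ v d * hcx + orbitPullback hρ v c * hdy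
    | smul r x _ hx =>
      obtain ⟨c, hc, hcx⟩ := hx
      refine ⟨c, hc, ?_⟩
      rw [smul_eq_mul, mul_left_comm, hcx, mul_zero]
  have htop : Ideal.span (Set.range fun h => translate h a) = ⊤ := by
    by_contra hne
    obtain ⟨g, hg⟩ := exists_forall_mem_eq_zero hG hne
    refine ha (Subtype.ext (funext fun g' => ?_))
    have := hg _ (Ideal.subset_span ⟨g' * g⁻¹, rfl⟩)
    simpa using this
  obtain ⟨c, hc, hc1⟩ := key 1 (htop ▸ Submodule.mem_top)
  rw [mul_one] at hc1
  exact hc (orbitPullback_injective hρ hv (hc1.trans (map_zero _).symm))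

/-- If `G` has no nontrivial rational characters and an open orbit, every relative invariant is
constant: its character is a regular function obtained by restricting it to the orbit. -/
theorem isUnit_of_dvd_substitute (hG : IsLinearAlgebraicGroup G)
    (hX : rationalCharacters G = ⊥) {ρ : Representation ℂ G V} (hρ : IsRational ρ) {v : V}
    (hv : IsZariskiOpen (Set.range fun g : G => ρ g v)) {d : polynomialFunctions V} (hd : d ≠ 0)
    (h : ∀ g, substitute ρ g d ∣ d) : IsUnit d := by
  have hc : ∀ g : G, ∃ c : ℂ, ∀ w, (d : V → ℂ) (ρ g w) = c * (d : V → ℂ) w := by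
    intro g
    have h1 : d ∣ substitute ρ g d := by
      have := map_dvd (substitute ρ g) (h g⁻¹)
      rwa [substitute_substitute_inv] at this
    obtain ⟨u, hu⟩ := associated_of_dvd_dvd h1 (h g)
    obtain ⟨c, -, hc⟩ := exists_eq_algebraMap_of_isUnit u.isUnit
    refine ⟨c, fun w => ?_⟩
    rw [← substitute_apply, ← hu, hc, mul_comm]
    rfl
  choose c hc using hc
  have hdv : (d : V → ℂ) v ≠ 0 := by
    intro h0
    refine hd (eq_zero_of_forall_mem_isZariskiOpen hv ⟨v, 1, by simp⟩ ?_)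
    rintro _ ⟨g, rfl⟩
    rw [hc, h0, mul_zero]
  have hcv : ∀ g, c g = (d : V → ℂ) (ρ g v) * ((d : V → ℂ) v)⁻¹ := fun g => by
    rw [hc, mul_inv_cancel_right₀ hdv]
  let χ : G →* ℂˣ := MonoidHom.toHomUnits
    { toFun := c
      map_one' := by rw [hcv]; simp [hdv]
      map_mul' := fun g g' => by
        rw [hcv (g * g'), map_mul, Module.End.mul_apply, hc, hc, ← mul_assoc,
          mul_inv_cancel_right₀ hdv] }
  have hχ : ∀ g, (χ g : ℂ) = c g := fun g => rfl
  let a : coordinateRing G := orbitPullback hρ v (((d : V → ℂ) v)⁻¹ • d)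
  have ha : ∀ g, (a : G → ℂ) g = χ g := fun g => by
    rw [hχ, hcv, mul_comm]
    rfl
  obtain ⟨u, hu⟩ := isUnit_of_forall_ne_zero hG (a := a) fun g => by
    rw [ha]
    exact (χ g).ne_zero
  have hmem : χ ∈ rationalCharacters G := by
    refine ⟨?_, ?_⟩
    · convert a.2 using 1
      exact (funext ha).symm
    · convert (↑u⁻¹ : coordinateRing G).2 using 1
      ext g
      refine inv_eq_of_mul_eq_one_right ?_
      rw [← ha, ← hu]
      exact congr_fun (congr_arg Subtype.val u.mul_inv) g
  rw [hX, Subgroup.mem_bot] at hmem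
  have hconst : d = algebraMap ℂ _ ((d : V → ℂ) v) := by
    rw [← sub_eq_zero]
    refine eq_zero_of_forall_mem_isZariskiOpen hv ⟨v, 1, by simp⟩ ?_
    rintro _ ⟨g, rfl⟩
    have h1 : c g = 1 := by rw [← hχ, hmem]; rfl
    change (d : V → ℂ) (ρ g v) - (d : V → ℂ) v = 0
    rw [hc, h1, one_mul, sub_self]
  rw [hconst]
  exact (IsUnit.mk0 _ hdv).map (algebraMap ℂ (polynomialFunctions V))

/-- If `G` has no nontrivial rational characters and `dim G ≤ dim V`, the orbit map of an open orbit
is a finite morphism onto all of `V`, because the locus in `V` over which it fails to be finite is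
`G`-stable and contains no hypersurface. -/
theorem orbitPullback_isIntegral (hG : IsLinearAlgebraicGroup G)
    (hX : rationalCharacters G = ⊥) {ρ : Representation ℂ G V} (hρ : IsRational ρ) {v : V}
    (hv : IsZariskiOpen (Set.range fun g : G => ρ g v))
    (hdim : dimension G ≤ (Module.finrank ℂ V : WithBot ℕ∞)) :
    (orbitPullback hρ v).toRingHom.IsIntegral := by
  let : Algebra (polynomialFunctions V) (coordinateRing G) := (orbitPullback hρ v).toRingHom.toAlgebra
  have hsmul : ∀ (f : polynomialFunctions V) (a : coordinateRing G),
      f • a = orbitPullback hρ v f * a := fun _ _ => rfl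
  have : IsScalarTower ℂ (polynomialFunctions V) (coordinateRing G) :=
    .of_algebraMap_eq fun x => ((orbitPullback hρ v).commutes x).symm
  have : Module.IsTorsionFree (polynomialFunctions V) (coordinateRing G) := by
    refine .of_smul_eq_zero fun f a hfa => ?_
    rw [or_iff_not_imp_left]
    exact fun hf => eq_zero_of_orbitPullback_mul_eq_zero hG hρ hv hf hfa
  have : Algebra.IsAlgebraic (polynomialFunctions V) (coordinateRing G) :=
    isAlgebraic_of_ringKrullDim_le hdim (polynomialFunctionsEquiv (Module.finBasis ℂ V))
  -- the `f` such that the orbit map is finite over the locus where `f` does not vanish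
  let J : Set (polynomialFunctions V) :=
    {f | ∀ a : coordinateRing G, ∃ N : ℕ, IsIntegral (polynomialFunctions V) (f ^ N • a)}
  have hJ : ∀ h : G, ∀ f ∈ J, substitute ρ h f ∈ J := by
    intro h f hf a
    obtain ⟨N, hN⟩ := hf (translate h⁻¹ a)
    refine ⟨N, ?_⟩
    have hcomm : (algebraMap (polynomialFunctions V) (coordinateRing G)).comp
        (substitute ρ h).toRingHom = (translate h).toRingHom.comp (algebraMap _ _) :=
      RingHom.ext fun f => (translate_orbitPullback hρ v h f).symm
    convert hN.map_of_comp_eq _ _ hcomm using 1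
    change _ = translate h (_ • _)
    rw [hsmul, hsmul, map_mul, translate_orbitPullback, map_pow (substitute ρ h)]
    congr 1
    ext g
    simp
  obtain ⟨f₀, hf₀, hf₀J⟩ := exists_ne_zero_forall_exists_pow_smul_isIntegral ℂ
    (R := polynomialFunctions V) (A := coordinateRing G)
  -- since `J` is `G`-stable, its greatest common divisor `d` is a relative invariant
  obtain ⟨d, hd⟩ := exists_gcd_of_set J
  have hdJ := (hd d).mp dvd_rfl
  have hd0 : d ≠ 0 := by
    rintro rfl
    exact hf₀ (zero_dvd_iff.mp (hdJ f₀ hf₀J))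
  have hdu : IsUnit d := by
    refine isUnit_of_dvd_substitute hG hX hρ hv hd0 fun h => (hd _).mpr fun f hf => ?_
    rw [← substitute_substitute_inv ρ h f]
    exact map_dvd _ (hdJ _ (hJ _ f hf))
  intro a
  refine isIntegral_of_forall_prime (Algebra.IsAlgebraic.isAlgebraic a) fun p hp => ?_
  have : ¬ ∀ f ∈ J, p ∣ f := fun h => hp.not_isUnit (isUnit_of_dvd_unit ((hd p).mpr h) hdu)
  push Not at this
  obtain ⟨f, hf, hpf⟩ := this
  obtain ⟨N, hN⟩ := hf a
  exact ⟨f ^ N, fun h => hpf (hp.dvd_of_dvd_pow h), hN⟩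

/-- If the coordinate ring of `G` is integral over the polynomial functions on `V`, lying over and
the Nullstellensatz show that the orbit map reaches every point. -/
theorem surjective_orbit_of_isIntegral (hG : IsLinearAlgebraicGroup G)
    {ρ : Representation ℂ G V} (hρ : IsRational ρ) {v : V}
    (hv : IsZariskiOpen (Set.range fun g : G => ρ g v))
    (hint : (orbitPullback hρ v).toRingHom.IsIntegral) :
    Function.Surjective fun g : G => ρ g v := by
  intro w
  let : Algebra (polynomialFunctions V) (coordinateRing G) := (orbitPullback hρ v).toRingHom.toAlgebra
  have : Algebra.IsIntegral (polynomialFunctions V) (coordinateRing G) := ⟨hint⟩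
  let ev : polynomialFunctions V →ₐ[ℂ] ℂ :=
    (Pi.evalAlgHom ℂ (fun _ : V => ℂ) w).comp (polynomialFunctions V).val
  have hker : (RingHom.ker (algebraMap (polynomialFunctions V) (coordinateRing G))) = ⊥ :=
    (RingHom.injective_iff_ker_eq_bot _).mp (orbitPullback_injective hρ hv)
  have : (RingHom.ker ev).IsPrime := RingHom.ker_isPrime ev.toRingHom
  obtain ⟨Q, -, hQ, hQw⟩ := Ideal.exists_ideal_over_prime_of_isIntegral
    (S := coordinateRing G) (RingHom.ker ev) ⊥ (by
      rw [← RingHom.ker_eq_comap_bot, hker]; exact bot_le)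
  obtain ⟨g, hg⟩ := exists_forall_mem_eq_zero hG hQ.ne_top
  refine ⟨g, ?_⟩
  rw [← sub_eq_zero, ← Module.forall_dual_apply_eq_zero_iff ℂ]
  intro φ
  let f : polynomialFunctions V :=
    ⟨fun w => φ w, linearForm_mem_polynomialFunctions φ⟩ - algebraMap ℂ _ (φ w)
  have hf : f ∈ RingHom.ker ev := by
    change φ w - φ w = 0
    exact sub_self _
  rw [← hQw] at hf
  rw [map_sub]
  exact hg _ hf

end OrbitMap

end EtaleModule

theorem proposition4p4 {m : ℕ} (G : Subgroup (Matrix.GeneralLinearGroup (Fin m) ℂ))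
    (hG : EtaleModule.IsLinearAlgebraicGroup G)
    (hX : EtaleModule.rationalCharacters G = ⊥)
    (V : Type*) [AddCommGroup V] [Module ℂ V] [FiniteDimensional ℂ V]
    (hV : 0 < Module.finrank ℂ V) :
    ¬ ∃ ρ : Representation ℂ G V, EtaleModule.IsEtale ρ := by
  rintro ⟨ρ, ⟨hρ, v, hv⟩, hdim⟩
  have hsurj := EtaleModule.surjective_orbit_of_isIntegral hG hρ hv
    (EtaleModule.orbitPullback_isIntegral hG hX hρ hv hdim.le)
  obtain ⟨g, hg⟩ := hsurj 0
  -- an orbit through `0` is `{0}`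
  have hv0 : v = 0 := by simpa using congr_arg (ρ g⁻¹) hg
  have := Module.nontrivial_of_finrank_pos hV
  obtain ⟨w, hw⟩ := exists_ne (0 : V)
  obtain ⟨h, hh⟩ := hsurj w
  exact hw (by rw [← hh, hv0]; exact map_zero _)
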